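/- Let $(u_k)_{k\ge 1}$ be a strictly increasing sequence of positive real numbers, put $u_0:=0$, and assume that (i) there is a constant $c>0$ such that $1+u_{k-1}^2\ge c\,(u_k-u_{k-1})^2$ for all integers $k\ge 1$; (ii) $\displaystyle \sup_{n\in\mathbb N}\ \sup_{1\le l\le n}\left(\frac{u_{n+2l}-u_{n+l}}{u_{n+l}-u_n}+\frac{u_{n+l}-u_n}{u_{n+2l}-u_{n+l}}\right)<\infty .$ For a closed, nondegenerate, not necessarily axis-parallel rectangle $R\subset\mathbb R^2$, let $l(R)$ be the length of its shortest side, and let its slope be the slope of the line that carries its longest side (if $R$ is a square: the tangent of the smallest angle between one of its sides and the horizontal axis). Then there is a sequence $(R_k)_{k\in\mathbb N}$ of such rectangles, all containing the origin, with $\lim_{k\to\infty} l(R_k)=\infty$, such that (a) for every $k\ge 1$ the slope of $R_k$ is $1/u_k$; (b) the associated discrete maximal operator $$A^*\varphi(k,l)=\sup_{n\ge 1}\frac{1}{\#(R_n\cap\mathbb Z^2)}\sum_{(i,j)\in R_n\cap\mathbb Z^2}|\varphi(k+i,l+j)|,\qquad (k,l)\in\mathbb Z^2,$$ does not satisfy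 a Tauberian condition; that is, it is not the case that for every $\lambda>0$ there is a constant $C_\lambda>0$ such that $$\#\{(k,l)\in\mathbb Z^2: A^*\chi_E(k,l)\ge\lambda\}\le C_\lambda\,\# E$$ for all finite nonempty sets $E\subset\mathbb Z^2$. -/

import Mathlib

open Filter
open scoped ENNReal

/-- A closed nondegenerate rectangle in the plane, in arbitrary position: its centre, a unit vector
`dir` parallel to a longest side, and the lengths `long ≥ short > 0` of its sides. -/
structure PlaneRectangle where
  center : ℝ × ℝ
  dir : ℝ × ℝ
  dir_unit : dir.1 ^ 2 + dir.2 ^ 2 = 1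
  long : ℝ
  short : ℝ
  short_pos : 0 < short
  short_le_long : short ≤ long

namespace PlaneRectangle

/-- The set of points of the rectangle: the coordinates relative to the centre, in the orthonormal
frame `(d₁, d₂)`, `(-d₂, d₁)`, are at most half of the corresponding side length. -/
def toSet (R : PlaneRectangle) : Set (ℝ × ℝ) :=
  {x | |(x.1 - R.center.1) * R.dir.1 + (x.2 - R.center.2) * R.dir.2| ≤ R.long / 2 ∧
    |(x.2 - R.center.2) * R.dir.1 - (x.1 - R.center.1) * R.dir.2| ≤ R.short / 2}

/-- `R.HasSlope m`: the slope of `R` is the real number `m`.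
If `R` is not a square, `m` is the slope of its longest side (this excludes a vertical one, as
`dir` is a unit vector). If `R` is a square, `m` is the tangent of the smallest angle between one
of its sides and the horizontal axis; the sides are parallel to `(d₁, d₂)` and `(-d₂, d₁)`, so that
this tangent is `min |d₁| |d₂| / max |d₁| |d₂|`. -/
def HasSlope (R : PlaneRectangle) (m : ℝ) : Prop :=
  (R.short < R.long → R.dir.2 = m * R.dir.1) ∧
    (R.short = R.long → min |R.dir.1| |R.dir.2| = m * max |R.dir.1| |R.dir.2|)

theorem latticePoints_finite (R : PlaneRectangle) :
    {q : ℤ × ℤ | ((q.1 : ℝ), (q.2 : ℝ)) ∈ R.toSet}.Finite := by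
  have hd1 : |R.dir.1| ≤ 1 := by
    rw [← sq_le_one_iff_abs_le_one]; nlinarith [R.dir_unit, sq_nonneg R.dir.2]
  have hd2 : |R.dir.2| ≤ 1 := by
    rw [← sq_le_one_iff_abs_le_one]; nlinarith [R.dir_unit, sq_nonneg R.dir.1]
  have key : ∀ a b A B : ℝ, |a| ≤ A → |b| ≤ B → ∀ s t : ℝ, |s| ≤ 1 → |t| ≤ 1 →
      |a * s + b * t| ≤ A + B := by
    intro a b A B ha hb s t hs ht
    calc |a * s + b * t| ≤ |a| * |s| + |b| * |t| := by
          simpa [abs_mul] using abs_add_le (a * s) (b * t)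
      _ ≤ |a| * 1 + |b| * 1 := by gcongr
      _ ≤ A + B := by linarith
  set r : ℝ := R.long / 2 + R.short / 2 with hr
  refine ((Set.finite_Icc ⌊R.center.1 - r⌋ ⌈R.center.1 + r⌉).prod
    (Set.finite_Icc ⌊R.center.2 - r⌋ ⌈R.center.2 + r⌉)).subset ?_
  rintro ⟨i, j⟩ ⟨h1, h2⟩
  simp only at h1 h2
  have hu := R.dir_unit
  have e1 := key _ _ _ _ h1 h2 R.dir.1 (-R.dir.2) hd1 (by simpa using hd2)
  have e2 := key _ _ _ _ h1 h2 R.dir.2 R.dir.1 hd2 hd1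
  have f1 : |(i : ℝ) - R.center.1| ≤ r := by
    convert e1 using 2
    linear_combination (-((i : ℝ) - R.center.1)) * hu
  have f2 : |(j : ℝ) - R.center.2| ≤ r := by
    convert e2 using 2
    linear_combination (-((j : ℝ) - R.center.2)) * hu
  rw [abs_le] at f1 f2
  refine ⟨⟨?_, ?_⟩, ⟨?_, ?_⟩⟩
  · exact_mod_cast (Int.floor_le _).trans (by linarith [f1.1] : R.center.1 - r ≤ (i : ℝ))
  · exact_mod_cast (by linarith [f1.2] : (i : ℝ) ≤ R.center.1 + r).trans (Int.le_ceil _)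
  · exact_mod_cast (Int.floor_le _).trans (by linarith [f2.1] : R.center.2 - r ≤ (j : ℝ))
  · exact_mod_cast (by linarith [f2.2] : (j : ℝ) ≤ R.center.2 + r).trans (Int.le_ceil _)

/-- The finite set `R ∩ ℤ²`. -/
noncomputable def latticePoints (R : PlaneRectangle) : Finset (ℤ × ℤ) :=
  R.latticePoints_finite.toFinset

/-- The average of `φ : ℤ² → ℝ` over the lattice points of the translate of `R` by `p`. -/
noncomputable def average (R : PlaneRectangle) (φ : ℤ × ℤ → ℝ) (p : ℤ × ℤ) : ℝ :=
  (1 / (R.latticePoints.card : ℝ)) * ∑ q ∈ R.latticePoints, φ (p + q)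

end PlaneRectangle

/-- A process: a sequence of rectangles which contain the origin and whose shortest sides tend to
infinity. -/
def IsProcess (R : ℕ → PlaneRectangle) : Prop :=
  (∀ k, (0, 0) ∈ (R k).toSet) ∧ Tendsto (fun k => (R k).short) atTop atTop

/-- The discrete maximal operator `A^* φ = sup_{n ≥ 1} A_n |φ|`, with values in `[0, ∞]`. -/
noncomputable def discreteMaximal (R : ℕ → PlaneRectangle) (φ : ℤ × ℤ → ℝ) (p : ℤ × ℤ) : ℝ≥0∞ :=
  ⨆ n : ℕ, ⨆ _ : 1 ≤ n, ENNReal.ofReal ((R n).average (fun q => |φ q|) p)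

/-- The Tauberian condition for the discrete maximal operator: for every `lam > 0` there is `C > 0`
with `#{A^* χ_E ≥ lam} ≤ C #E` for all finite nonempty `E ⊆ ℤ²`. -/
def SatisfiesTauberian (R : ℕ → PlaneRectangle) : Prop :=
  ∀ lam : ℝ, 0 < lam → ∃ C : ℝ, 0 < C ∧ ∀ E : Finset (ℤ × ℤ), E.Nonempty →
    (({p : ℤ × ℤ | ENNReal.ofReal lam ≤
        discreteMaximal R ((E : Set (ℤ × ℤ)).indicator fun _ => 1) p}.encard : ℕ∞) : ℝ≥0∞)
      ≤ ENNReal.ofReal C * (E.card : ℝ≥0∞)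

/-- The Perron factor
`sup_n sup_{1 ≤ l ≤ n} ((u_{n+2l} - u_{n+l})/(u_{n+l} - u_n) + (u_{n+l} - u_n)/(u_{n+2l} - u_{n+l}))`
of a (strictly increasing) sequence, as an element of `[0, ∞]`. -/
noncomputable def perronFactor (u : ℕ → ℝ) : ℝ≥0∞ :=
  ⨆ n : ℕ, ⨆ l : ℕ, ⨆ _ : 1 ≤ l ∧ l ≤ n,
    ENNReal.ofReal ((u (n + 2 * l) - u (n + l)) / (u (n + l) - u n) +
      (u (n + l) - u n) / (u (n + 2 * l) - u (n + l)))

/-!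
A Perron tree is built directly in the lattice, with slopes `1 / u K` for `K` in one dyadic block
`[2 ^ (2 * M), 2 ^ (2 * M + 1))` and with a scale `S` that depends on the block only. To each index
`K` belongs the strip of the points `(x, j)` with
`x - S * a K - u K * j ∈ [0, S * (u (K + 1) - u K))`, where
`a K = -(1 / M) * ∑ i < 2 * M, (u K - u (⌊K⌋ᵢ))` and `⌊K⌋ᵢ` is the largest multiple of `2 ^ i`
that is at most `K`. Write `U` for the increment of `u` over the whole block.

* In a row `j = S * y` with `m / M ≤ y ≤ (m + 1) / M ≤ 1`, the `m` terms of highest level in `a K`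
  cancel the inclination `u K * y` up to an error of order `1 / M`. By the bound on the Perron
  factor, each increment of `u` over a dyadic interval is at most a constant times the increment
  over its dyadic neighbour, so that the increments at the lower levels telescope to a multiple of
  the increment `L` at level `2 * M - m`. Hence all strips belonging to one dyadic interval of that
  level meet the row in an interval of length `O(S * L / M)` (`branchPosition_le_tree`), and the
  whole tree has `O(S * U / M)` points in the row (`card_tree_row_le`). The lower part `E` of the
  tree, in the rows `0 ≤ j < S`, has therefore `O(S ^ 2 * U / M)` points.
* In the rows `3 * S ≤ j < 4 * S` the strips are disjoint, since the floors `⌊K⌋ᵢ` are monotone in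
  `K` (`sub_le_tree_sub`). The upper part of the tree has at least `S ^ 2 * U / 2` points
  (`le_card_latticeTree`).
* The rectangle `R K` is centred at the origin, and so large that its translate to any point of the
  upper part of the `K`-th strip contains the lower part of this strip. The growth condition bounds
  the width of the strip by a multiple of `√(1 + u K ^ 2)`, so that the rectangle has no more than a
  constant times as many lattice points as the lower part of the strip, and the average of the
  indicator function of `E` is bounded below (`le_average_of_mem_latticeStrip`).

Since `M` is arbitrary, the Tauberian condition fails for a single value `lam`.
-/

/-! ### Dyadic increments of a sequence -/

/-- The largest multiple of `2 ^ i` that is at most `K`. -/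
def dyadicFloor (i K : ℕ) : ℕ := K / 2 ^ i * 2 ^ i

/-- The increment of `u` over the dyadic interval of length `2 ^ i` which contains `K`. -/
def dyadicIncrement (u : ℕ → ℝ) (i K : ℕ) : ℝ :=
  u (dyadicFloor i K + 2 ^ i) - u (dyadicFloor i K)

theorem dyadicFloor_le (i K : ℕ) : dyadicFloor i K ≤ K := Nat.div_mul_le_self _ _

theorem lt_dyadicFloor_add (i K : ℕ) : K < dyadicFloor i K + 2 ^ i := by
  have h := Nat.div_add_mod' K (2 ^ i)
  have h' := Nat.mod_lt K (Nat.two_pow_pos i)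
  unfold dyadicFloor
  omega

theorem dyadicFloor_mono (i : ℕ) {K K' : ℕ} (h : K ≤ K') : dyadicFloor i K ≤ dyadicFloor i K' :=
  Nat.mul_le_mul_right _ (Nat.div_le_div_right h)

theorem dyadicFloor_dyadicFloor {i h : ℕ} (hi : h ≤ i) (K : ℕ) :
    dyadicFloor i (dyadicFloor h K) = dyadicFloor i K := by
  obtain ⟨d, rfl⟩ := Nat.exists_eq_add_of_le hi
  have hp : 0 < 2 ^ h := by positivity
  simp only [dyadicFloor, pow_add, ← Nat.div_div_eq_div_mul, Nat.mul_div_cancel _ hp]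

theorem dyadicFloor_eq_or (i K : ℕ) : dyadicFloor i K = dyadicFloor (i + 1) K ∨
    dyadicFloor i K = dyadicFloor (i + 1) K + 2 ^ i := by
  simp only [dyadicFloor, pow_succ, ← Nat.div_div_eq_div_mul]
  rcases Nat.even_or_odd' (K / 2 ^ i) with ⟨b, hb | hb⟩
  · left
    rw [hb, Nat.mul_div_cancel_left _ two_pos]; ring
  · right
    rw [hb, show (2 * b + 1) / 2 = b by omega]; ring

/-- Adjacent increments of `u` over index intervals of equal length `l`, of which the first begins
at an index `n ≥ l`, are comparable with the constant `B`. -/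
def HasPerronBound (u : ℕ → ℝ) (B : ℝ) : Prop :=
  ∀ n l : ℕ, 1 ≤ l → l ≤ n → u (n + 2 * l) - u (n + l) ≤ B * (u (n + l) - u n) ∧
    u (n + l) - u n ≤ B * (u (n + 2 * l) - u (n + l))

section Increments

variable {u : ℕ → ℝ} {B : ℝ}

theorem sub_dyadicFloor_le (hu : Monotone u) (i K : ℕ) :
    u K - u (dyadicFloor i K) ≤ dyadicIncrement u i K :=
  sub_le_sub_right (hu (lt_dyadicFloor_add i K).le) _

theorem increment_le_dyadicIncrement (hu : Monotone u) (i K : ℕ) :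
    u (K + 1) - u K ≤ dyadicIncrement u i K :=
  sub_le_sub (hu (lt_dyadicFloor_add i K)) (hu (dyadicFloor_le i K))

/-- The increments over the two halves of a dyadic interval away from the origin are comparable. -/
theorem dyadicIncrement_le_mul_sub
    (hB : HasPerronBound u B)
    {i K : ℕ} (hK : 2 ^ (i + 1) ≤ K) :
    dyadicIncrement u i K ≤ B * (dyadicIncrement u (i + 1) K - dyadicIncrement u i K) := by
  have hn : 2 ^ i ≤ dyadicFloor (i + 1) K := by
    have h1 : 1 ≤ K / 2 ^ (i + 1) := (Nat.one_le_div_iff (by positivity)).2 hK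
    calc 2 ^ i ≤ 1 * 2 ^ (i + 1) := by rw [pow_succ]; omega
      _ ≤ _ := Nat.mul_le_mul_right _ h1
  obtain ⟨h1, h2⟩ := hB _ _ Nat.one_le_two_pow hn
  unfold dyadicIncrement
  rw [pow_succ', two_mul, ← add_assoc] at *
  rcases dyadicFloor_eq_or i K with h | h
  · rw [h]; convert h2 using 2; ring
  · rw [h]; convert h1 using 2; ring

/-- By the comparability of neighbours, the sum telescopes. -/
theorem sum_dyadicIncrement_le
    (hB : HasPerronBound u B)
    (hu : Monotone u) (hB0 : 0 ≤ B) {h K : ℕ} (hK : 2 ^ h ≤ K) :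
    ∑ i ∈ Finset.range h, dyadicIncrement u i K ≤ B * dyadicIncrement u h K := by
  calc ∑ i ∈ Finset.range h, dyadicIncrement u i K
      ≤ ∑ i ∈ Finset.range h, B * (dyadicIncrement u (i + 1) K - dyadicIncrement u i K) := by
        refine Finset.sum_le_sum fun i hi => dyadicIncrement_le_mul_sub hB (le_trans ?_ hK)
        exact Nat.pow_le_pow_right two_pos (Finset.mem_range.1 hi)
    _ = B * (dyadicIncrement u h K - dyadicIncrement u 0 K) := by
        rw [← Finset.mul_sum, Finset.sum_range_sub (fun i => dyadicIncrement u i K)]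
    _ ≤ _ := by
        have : 0 ≤ dyadicIncrement u 0 K := sub_nonneg.2 (hu (Nat.le_add_right _ _))
        exact mul_le_mul_of_nonneg_left (by linarith) hB0

/-! ### The position of the strips of the tree -/

/-- The position at height `0` of the `K`-th line of the tree; its slope is `1 / u K`. -/
noncomputable def treeShift (u : ℕ → ℝ) (M K : ℕ) : ℝ :=
  -(1 / (M : ℝ)) * ∑ i ∈ Finset.range (2 * M), (u K - u (dyadicFloor i K))

/-- The common part of the positions at height `y ∈ [m / M, (m + 1) / M]` of the lines of the tree
whose index has the dyadic floor `q` at level `2 * M - m`. -/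
noncomputable def branchPosition (u : ℕ → ℝ) (M m q : ℕ) (y : ℝ) : ℝ :=
  (y - m / M) * u q + 1 / M * ∑ i ∈ Finset.Ico (2 * M - m) (2 * M), u (dyadicFloor i q)

/-- Above height `3` the lines of the tree are spread out at least as much as the sequence `u`. -/
theorem sub_le_tree_sub (hu : Monotone u) {M : ℕ} (hM : 1 ≤ M) {K K' : ℕ} (hK : K ≤ K') {y : ℝ}
    (hy : 3 ≤ y) :
    u K' - u K ≤ (treeShift u M K' + u K' * y) - (treeShift u M K + u K * y) := by
  have hM' : (0 : ℝ) < M := by exact_mod_cast hM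
  have h1 : ∑ i ∈ Finset.range (2 * M), (u K' - u (dyadicFloor i K')) -
      ∑ i ∈ Finset.range (2 * M), (u K - u (dyadicFloor i K)) ≤ 2 * M * (u K' - u K) := by
    rw [← Finset.sum_sub_distrib]
    refine (Finset.sum_le_card_nsmul _ _ (u K' - u K) fun i _ => ?_).trans ?_
    · linarith [hu (dyadicFloor_mono i hK)]
    · simp
  have h2 : 1 / (M : ℝ) * (∑ i ∈ Finset.range (2 * M), (u K' - u (dyadicFloor i K')) -
      ∑ i ∈ Finset.range (2 * M), (u K - u (dyadicFloor i K))) ≤ 2 * (u K' - u K) := by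
    rw [one_div, inv_mul_le_iff₀ hM']; linarith
  have h3 := hu hK
  unfold treeShift
  nlinarith [mul_nonneg (sub_nonneg.2 h3) (sub_nonneg.2 hy)]

/-- Below height `1` the strips of the tree which belong to the same dyadic interval are squeezed
into a common interval, shorter by a factor of order `M` than the increment of `u` over that
dyadic interval. The terms of level at least `2 * M - m` in `treeShift` cancel the inclination of
the lines up to an error `1 / M`; the terms of lower level are controlled by
`sum_dyadicIncrement_le`. -/
theorem branchPosition_le_tree
    (hB : HasPerronBound u B)
    (hu : Monotone u) (hB0 : 0 ≤ B) {M m K : ℕ} (hm : m < M) (hK : 2 ^ (2 * M) ≤ K) {y : ℝ}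
    (hy : m / M ≤ y) (hy' : y ≤ (m + 1) / M) :
    branchPosition u M m (dyadicFloor (2 * M - m) K) y
        - B * dyadicIncrement u (2 * M - m) K / M ≤ treeShift u M K + u K * y ∧
      treeShift u M K + u K * y + (u (K + 1) - u K) ≤
        branchPosition u M m (dyadicFloor (2 * M - m) K) y
          + (1 + B) * dyadicIncrement u (2 * M - m) K / M := by
  have hM' : (0 : ℝ) < M := by exact_mod_cast (Nat.zero_le m).trans_lt hm
  set h := 2 * M - m with hh
  set L := dyadicIncrement u h K with hL
  set T := ∑ i ∈ Finset.range h, (u K - u (dyadicFloor i K)) with hT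
  have hS : ∑ i ∈ Finset.range h, dyadicIncrement u i K ≤ B * L :=
    sum_dyadicIncrement_le hB hu hB0 ((Nat.pow_le_pow_right two_pos (by omega)).trans hK)
  have hT0 : 0 ≤ T := Finset.sum_nonneg fun i _ => sub_nonneg.2 (hu (dyadicFloor_le i K))
  have hTL : T ≤ B * L := (Finset.sum_le_sum fun i _ => sub_dyadicFloor_le hu i K).trans hS
  -- there are at least `M` lower levels, and the dyadic increment at each of them is at
  -- least `u (K + 1) - u K`
  have hw : M * (u (K + 1) - u K) ≤ B * L := by
    calc M * (u (K + 1) - u K) ≤ h * (u (K + 1) - u K) := by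
          refine mul_le_mul_of_nonneg_right ?_ (sub_nonneg.2 (hu K.le_succ))
          exact_mod_cast (by omega : M ≤ h)
      _ ≤ ∑ i ∈ Finset.range h, dyadicIncrement u i K := by
          simpa using Finset.card_nsmul_le_sum (Finset.range h) _ _
            fun i _ => increment_le_dyadicIncrement hu i K
      _ ≤ B * L := hS
  have hw' : u (K + 1) - u K ≤ B * L / M := by rw [le_div_iff₀ hM']; linarith
  -- the difference to the position of the branch
  have key : treeShift u M K + u K * y - branchPosition u M m (dyadicFloor h K) y =
      (y - m / M) * (u K - u (dyadicFloor h K)) - T / M := by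
    have e1 : ∑ i ∈ Finset.Ico h (2 * M), u (dyadicFloor i (dyadicFloor h K)) =
        ∑ i ∈ Finset.Ico h (2 * M), u (dyadicFloor i K) :=
      Finset.sum_congr rfl fun i hi => by
        rw [dyadicFloor_dyadicFloor (Finset.mem_Ico.1 hi).1]
    have e2 : ∑ i ∈ Finset.range (2 * M), (u K - u (dyadicFloor i K)) =
        T + (m * u K - ∑ i ∈ Finset.Ico h (2 * M), u (dyadicFloor i K)) := by
      rw [← Finset.sum_range_add_sum_Ico _ (by omega : h ≤ 2 * M), ← hT,
        Finset.sum_sub_distrib _ _ (s := Finset.Ico h (2 * M))]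
      simp [show 2 * M - h = m by omega]
    unfold treeShift branchPosition
    rw [← hh, e1, e2]
    field_simp
    ring
  have hd0 : 0 ≤ u K - u (dyadicFloor h K) := sub_nonneg.2 (hu (dyadicFloor_le h K))
  have hd1 : u K - u (dyadicFloor h K) ≤ L := sub_dyadicFloor_le hu h K
  have ha : 0 ≤ (y - m / M) * (u K - u (dyadicFloor h K)) := mul_nonneg (by linarith) hd0
  have hb : (y - m / M) * (u K - u (dyadicFloor h K)) ≤ L / M := by
    calc _ ≤ 1 / (M : ℝ) * L := by
          refine mul_le_mul ?_ hd1 hd0 (by positivity)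
          rw [add_div] at hy'; linarith
      _ = L / M := by ring
  have hc : 0 ≤ T / M := by positivity
  have hd : T / M ≤ B * L / M := by gcongr
  constructor
  · linarith
  · rw [show (1 + B) * L / M = L / M + B * L / M by ring]
    linarith

end Increments

/-! ### Lattice points in strips -/

/-- The integers of the interval `[a, a + w)`. -/
noncomputable def integersIn (a w : ℝ) : Finset ℤ := Finset.Ico ⌈a⌉ ⌈a + w⌉

theorem mem_integersIn {a w : ℝ} {x : ℤ} : x ∈ integersIn a w ↔ a ≤ x ∧ (x : ℝ) < a + w := by
  simp [integersIn, Int.ceil_le, Int.lt_ceil]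

theorem card_integersIn_le {a w : ℝ} (hw : 0 ≤ w) : ((integersIn a w).card : ℝ) ≤ w + 1 := by
  have h : ⌈a⌉ ≤ ⌈a + w⌉ := Int.ceil_mono (by linarith)
  have h1 : ((integersIn a w).card : ℝ) = ((⌈a + w⌉ - ⌈a⌉ : ℤ) : ℝ) := by
    rw [integersIn, ← Int.card_Ico_of_le _ _ h, Int.cast_natCast]
  rw [h1]; push_cast
  linarith [Int.ceil_lt_add_one (a + w), Int.le_ceil a]

theorem le_card_integersIn {a w : ℝ} (hw : 0 ≤ w) : w - 1 ≤ ((integersIn a w).card : ℝ) := by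
  have h : ⌈a⌉ ≤ ⌈a + w⌉ := Int.ceil_mono (by linarith)
  have h1 : ((integersIn a w).card : ℝ) = ((⌈a + w⌉ - ⌈a⌉ : ℤ) : ℝ) := by
    rw [integersIn, ← Int.card_Ico_of_le _ _ h, Int.cast_natCast]
  rw [h1]; push_cast
  linarith [Int.ceil_lt_add_one a, Int.le_ceil (a + w)]

/-- The lattice points which lie, in a row `j ∈ J`, in the interval `[α j, α j + w)`. -/
noncomputable def latticeStrip (α : ℤ → ℝ) (w : ℝ) (J : Finset ℤ) : Finset (ℤ × ℤ) :=
  J.biUnion fun j => (integersIn (α j) w).map (Function.Embedding.sectL ℤ j)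

theorem mem_latticeStrip {α : ℤ → ℝ} {w : ℝ} {J : Finset ℤ} {q : ℤ × ℤ} :
    q ∈ latticeStrip α w J ↔ q.2 ∈ J ∧ α q.2 ≤ q.1 ∧ (q.1 : ℝ) < α q.2 + w := by
  obtain ⟨x, j⟩ := q
  simp only [latticeStrip, Finset.mem_biUnion, Finset.mem_map, Function.Embedding.sectL_apply,
    Prod.mk.injEq, mem_integersIn]
  constructor
  · rintro ⟨i, hi, a, ha, rfl, rfl⟩; exact ⟨hi, ha⟩
  · rintro ⟨hj, h⟩; exact ⟨j, hj, x, h, rfl, rfl⟩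

theorem card_latticeStrip (α : ℤ → ℝ) (w : ℝ) (J : Finset ℤ) :
    (latticeStrip α w J).card = ∑ j ∈ J, (integersIn (α j) w).card := by
  rw [latticeStrip, Finset.card_biUnion]
  · simp
  · intro i _ j _ hij
    rw [Function.onFun, Finset.disjoint_left]
    simp only [Finset.mem_map, Function.Embedding.sectL_apply]
    rintro _ ⟨a, _, rfl⟩ ⟨b, _, h⟩
    exact hij (Prod.ext_iff.1 h).2.symm

theorem card_latticeStrip_le (α : ℤ → ℝ) {w : ℝ} (hw : 0 ≤ w) (J : Finset ℤ) :
    ((latticeStrip α w J).card : ℝ) ≤ J.card * (w + 1) := by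
  rw [card_latticeStrip, Nat.cast_sum, ← nsmul_eq_mul]
  exact Finset.sum_le_card_nsmul _ _ _ fun j _ => card_integersIn_le hw

theorem le_card_latticeStrip (α : ℤ → ℝ) {w : ℝ} (hw : 0 ≤ w) (J : Finset ℤ) :
    J.card * (w - 1) ≤ ((latticeStrip α w J).card : ℝ) := by
  rw [card_latticeStrip, Nat.cast_sum, ← nsmul_eq_mul]
  exact Finset.card_nsmul_le_sum _ _ _ fun j _ => le_card_integersIn hw

/-! ### Rectangles centred at the origin -/

namespace PlaneRectangle

theorem mem_latticePoints {R : PlaneRectangle} {q : ℤ × ℤ} :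
    q ∈ R.latticePoints ↔ ((q.1 : ℝ), (q.2 : ℝ)) ∈ R.toSet := by
  simp [latticePoints]

/-- The rectangle centred at the origin with slope `1 / u`, described without the normalization of
the direction vector `(u, 1)`. -/
theorem exists_centred (u : ℝ) {H w : ℝ} (hw : 0 < w) (hH : w < H * (1 + u ^ 2)) :
    ∃ R : PlaneRectangle, (u ≠ 0 → R.HasSlope (1 / u)) ∧ R.short = 2 * w / √(1 + u ^ 2) ∧
      ∀ x y : ℝ, (x, y) ∈ R.toSet ↔ |x * u + y| ≤ H * (1 + u ^ 2) ∧ |y * u - x| ≤ w := by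
  set s := √(1 + u ^ 2) with hs
  have hs0 : 0 < s := Real.sqrt_pos.2 (by positivity)
  have hs2 : s ^ 2 = 1 + u ^ 2 := Real.sq_sqrt (by positivity)
  have hlt : 2 * w / s < 2 * H * s := by
    rw [div_lt_iff₀ hs0]; nlinarith
  refine ⟨⟨(0, 0), (u / s, 1 / s), ?_, 2 * H * s, 2 * w / s, by positivity, hlt.le⟩, ?_, rfl, ?_⟩
  · simp only
    field_simp
    linarith
  · intro hu
    refine ⟨fun _ => ?_, fun h => absurd h hlt.ne⟩
    simp only
    field_simp
  · intro x y
    simp only [toSet, Set.mem_ofPred_eq, sub_zero]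
    rw [show x * (u / s) + y * (1 / s) = (x * u + y) / s by ring,
      show y * (u / s) - x * (1 / s) = (y * u - x) / s by ring, abs_div, abs_div, abs_of_pos hs0,
      div_le_iff₀ hs0, div_le_iff₀ hs0, ← hs2]
    field_simp

/-- A bound for the average of an indicator function from below: the translate of the rectangle
contains the set `P`. -/
theorem le_average_indicator (R : PlaneRectangle) {E P : Finset (ℤ × ℤ)} (hPE : P ⊆ E)
    {p : ℤ × ℤ} (hP : ∀ r ∈ P, r - p ∈ R.latticePoints) {lam : ℝ}
    (hP0 : P.Nonempty) (hcard : lam * R.latticePoints.card ≤ P.card) :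
    lam ≤ R.average (fun q => |(E : Set (ℤ × ℤ)).indicator (fun _ => (1 : ℝ)) q|) p := by
  have hmap : P.map (Equiv.subRight p).toEmbedding ⊆ R.latticePoints := by
    intro q hq
    obtain ⟨r, hr, rfl⟩ := Finset.mem_map.1 hq
    exact hP r hr
  have hpos : (0 : ℝ) < R.latticePoints.card := by
    exact_mod_cast ((Finset.map_nonempty.2 hP0).mono hmap).card_pos
  have hsum : (P.card : ℝ) ≤ ∑ q ∈ R.latticePoints,
      |(E : Set (ℤ × ℤ)).indicator (fun _ => (1 : ℝ)) (p + q)| := by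
    refine le_trans (le_of_eq ?_)
      (Finset.sum_le_sum_of_subset_of_nonneg hmap fun _ _ _ => abs_nonneg _)
    rw [Finset.sum_map, Finset.sum_congr rfl (g := fun _ => (1 : ℝ))]
    · simp
    · intro r hr
      simp [hPE hr]
  unfold average
  rw [one_div, inv_mul_eq_div, le_div_iff₀ hpos]
  exact hcard.trans hsum

end PlaneRectangle

/-! ### The size of the lower and upper parts of the tree -/

section Tree

variable {u : ℕ → ℝ} {B : ℝ}

/-- The lattice points in the rows `j ∈ J` of the strips of the tree with indices in
`[2 ^ (2 * M), 2 ^ (2 * M + 1))`, dilated by the factor `S`. -/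
noncomputable def latticeTree (u : ℕ → ℝ) (M S : ℕ) (J : Finset ℤ) : Finset (ℤ × ℤ) :=
  (Finset.Ico (2 ^ (2 * M)) (2 ^ (2 * M + 1))).biUnion fun K =>
    latticeStrip (fun j => S * treeShift u M K + u K * j) (S * (u (K + 1) - u K)) J

/-- A single row at height less than `S` of the tree. The strips are sorted by the
dyadic intervals of length `2 ^ (2 * M - m)`, for `m` adapted to the height of the row. -/
theorem card_tree_row_le
    (hB : HasPerronBound u B)
    (hu : Monotone u) (hB0 : 0 ≤ B) {M S j : ℕ} (hM : 1 ≤ M) (hj : j < S) :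
    (((Finset.Ico (2 ^ (2 * M)) (2 ^ (2 * M + 1))).biUnion fun K =>
      integersIn (S * treeShift u M K + u K * j) (S * (u (K + 1) - u K))).card : ℝ) ≤
      (1 + 2 * B) * S * (u (2 ^ (2 * M + 1)) - u (2 ^ (2 * M))) / M + 2 ^ (2 * M) := by
  have hM' : (0 : ℝ) < M := by exact_mod_cast hM
  have hS0 : 0 < S := (Nat.zero_le j).trans_lt hj
  have hS' : (0 : ℝ) < S := by exact_mod_cast hS0
  -- `m` is chosen such that `m / M ≤ j / S < (m + 1) / M`
  set m := j * M / S with hmdef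
  have hm : m < M := by
    rw [hmdef, Nat.div_lt_iff_lt_mul hS0, mul_comm]
    exact Nat.mul_lt_mul_of_pos_left hj hM
  set h := 2 * M - m with hh
  have hmh : m + h = 2 * M := by omega
  set y : ℝ := j / S with hy
  have hy1 : (m : ℝ) / M ≤ y := by
    rw [hy, div_le_div_iff₀ hM' hS']
    exact_mod_cast Nat.div_mul_le_self (j * M) S
  have hy2 : y ≤ ((m : ℝ) + 1) / M := by
    rw [hy, div_le_div_iff₀ hS' hM']
    exact_mod_cast ((Nat.div_lt_iff_lt_mul hS0).1 (Nat.lt_succ_self m)).le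
  set L : ℕ → ℝ := fun p => u ((p + 1) * 2 ^ h) - u (p * 2 ^ h) with hL
  have hL0 : ∀ p, 0 ≤ L p := fun p =>
    sub_nonneg.2 (hu (Nat.mul_le_mul_right _ p.le_succ))
  have hsub : ((Finset.Ico (2 ^ (2 * M)) (2 ^ (2 * M + 1))).biUnion fun K =>
      integersIn (S * treeShift u M K + u K * j) (S * (u (K + 1) - u K))) ⊆
      (Finset.Ico (2 ^ m) (2 ^ (m + 1))).biUnion fun p =>
        integersIn (S * (branchPosition u M m (p * 2 ^ h) y - B * L p / M))
          ((1 + 2 * B) * S * L p / M) := by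
    intro x hx
    obtain ⟨K, hK, hx⟩ := Finset.mem_biUnion.1 hx
    rw [Finset.mem_Ico] at hK
    rw [mem_integersIn] at hx
    refine Finset.mem_biUnion.2 ⟨K / 2 ^ h, ?_, ?_⟩
    · rw [Finset.mem_Ico, Nat.le_div_iff_mul_le (by positivity),
        Nat.div_lt_iff_lt_mul (by positivity), ← pow_add, ← pow_add, hmh,
        show m + 1 + h = 2 * M + 1 by omega]
      exact hK
    · obtain ⟨h1, h2⟩ := branchPosition_le_tree hB hu hB0 hm hK.1 hy1 hy2
      rw [← hh] at h1 h2
      have hLK : dyadicIncrement u h K = L (K / 2 ^ h) := by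
        simp only [hL, dyadicIncrement, dyadicFloor, add_mul, one_mul]
      rw [hLK] at h1 h2
      unfold dyadicFloor at h1 h2
      have e : S * treeShift u M K + u K * j = S * (treeShift u M K + u K * y) := by
        rw [hy]; field_simp
      have h1' := mul_le_mul_of_nonneg_left h1 hS'.le
      have h2' := mul_le_mul_of_nonneg_left h2 hS'.le
      rw [mem_integersIn]
      constructor
      · linarith
      · refine lt_of_lt_of_le (b := S * (treeShift u M K + u K * y + (u (K + 1) - u K)))
          (by linarith) (h2'.trans (le_of_eq ?_))
        ring
  refine (Nat.cast_le.2 ((Finset.card_le_card hsub).trans Finset.card_biUnion_le)).trans ?_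
  rw [Nat.cast_sum]
  calc ∑ p ∈ Finset.Ico (2 ^ m) (2 ^ (m + 1)), (((integersIn
          (S * (branchPosition u M m (p * 2 ^ h) y - B * L p / M))
          ((1 + 2 * B) * S * L p / M)).card : ℕ) : ℝ)
      ≤ ∑ p ∈ Finset.Ico (2 ^ m) (2 ^ (m + 1)), ((1 + 2 * B) * S * L p / M + 1) :=
        Finset.sum_le_sum fun p _ => card_integersIn_le (by have := hL0 p; positivity)
    _ = (1 + 2 * B) * S * (∑ p ∈ Finset.Ico (2 ^ m) (2 ^ (m + 1)), L p) / M + 2 ^ m := by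
        rw [Finset.sum_add_distrib, Finset.mul_sum, Finset.sum_div]
        simp [pow_succ, mul_two]
    _ ≤ _ := by
        rw [hL, Finset.sum_Ico_sub (fun p => u (p * 2 ^ h))
            (Nat.pow_le_pow_right two_pos m.le_succ),
          ← pow_add, ← pow_add, hmh, show m + 1 + h = 2 * M + 1 by omega]
        gcongr
        · norm_num
        · omega

theorem card_latticeTree_le
    (hB : HasPerronBound u B)
    (hu : Monotone u) (hB0 : 0 ≤ B) {M S : ℕ} (hM : 1 ≤ M) :
    ((latticeTree u M S (Finset.Ico 0 (S : ℤ))).card : ℝ) ≤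
      S * ((1 + 2 * B) * S * (u (2 ^ (2 * M + 1)) - u (2 ^ (2 * M))) / M + 2 ^ (2 * M)) := by
  have hsub : latticeTree u M S (Finset.Ico 0 (S : ℤ)) ⊆ (Finset.range S).biUnion fun j =>
      ((Finset.Ico (2 ^ (2 * M)) (2 ^ (2 * M + 1))).biUnion fun K =>
        integersIn (S * treeShift u M K + u K * j) (S * (u (K + 1) - u K))).map
          (Function.Embedding.sectL ℤ (j : ℤ)) := by
    rintro ⟨x, j⟩ hx
    obtain ⟨K, hK, hx⟩ := Finset.mem_biUnion.1 hx
    obtain ⟨hj, hx⟩ := mem_latticeStrip.1 hx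
    obtain ⟨hj0, hj1⟩ : 0 ≤ j ∧ j < S := Finset.mem_Ico.1 hj
    lift j to ℕ using hj0
    refine Finset.mem_biUnion.2 ⟨j, Finset.mem_range.2 (by exact_mod_cast hj1),
      Finset.mem_map.2 ⟨x, Finset.mem_biUnion.2 ⟨K, hK, mem_integersIn.2 ?_⟩, rfl⟩⟩
    simpa using hx
  refine (Nat.cast_le.2 ((Finset.card_le_card hsub).trans Finset.card_biUnion_le)).trans ?_
  rw [Nat.cast_sum]
  refine (Finset.sum_le_card_nsmul _ _ _ fun j hj => ?_).trans
    (le_of_eq (by rw [Finset.card_range, nsmul_eq_mul]))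
  rw [Finset.card_map]
  exact card_tree_row_le hB hu hB0 hM (Finset.mem_range.1 hj)

/-- Above height `3 * S` the strips of the tree are disjoint. -/
theorem le_card_latticeTree (hu : Monotone u) {M S : ℕ} (hM : 1 ≤ M)
    (hS : ∀ K < 2 ^ (2 * M + 1), 2 ≤ S * (u (K + 1) - u K)) :
    S * (S * (u (2 ^ (2 * M + 1)) - u (2 ^ (2 * M)))) / 2 ≤
      ((latticeTree u M S (Finset.Ico (3 * S : ℤ) (4 * S))).card : ℝ) := by
  set I := Finset.Ico (2 ^ (2 * M)) (2 ^ (2 * M + 1)) with hI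
  have hdisj : ∀ K ∈ I, ∀ K' ∈ I, K < K' →
      Disjoint (latticeStrip (fun j => S * treeShift u M K + u K * j) (S * (u (K + 1) - u K))
          (Finset.Ico (3 * S : ℤ) (4 * S)))
        (latticeStrip (fun j => S * treeShift u M K' + u K' * j) (S * (u (K' + 1) - u K'))
          (Finset.Ico (3 * S : ℤ) (4 * S))) := by
    intro K _ K' _ hKK
    rw [Finset.disjoint_left]
    intro q hq hq'
    obtain ⟨hj, -, h1⟩ := mem_latticeStrip.1 hq
    obtain ⟨-, h2, -⟩ := mem_latticeStrip.1 hq'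
    obtain ⟨hj1, hj2⟩ := Finset.mem_Ico.1 hj
    have hS0 : (0 : ℝ) < S := by
      have : 0 < (S : ℤ) := by omega
      exact_mod_cast this
    have hy : (3 : ℝ) ≤ q.2 / S := by
      rw [le_div_iff₀ hS0]; exact_mod_cast hj1
    have h3 := mul_le_mul_of_nonneg_left (sub_le_tree_sub hu hM hKK.le hy) hS0.le
    have h4 : S * (u (K + 1) - u K) ≤ S * (u K' - u K) :=
      mul_le_mul_of_nonneg_left (by linarith [hu (Nat.succ_le_of_lt hKK)]) hS0.le
    have e : ∀ a b : ℝ, S * (a + b * (q.2 / S)) = S * a + b * q.2 := by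
      intro a b; field_simp
    rw [mul_sub (S : ℝ) (treeShift u M K' + _), e, e] at h3
    linarith
  rw [latticeTree, Finset.card_biUnion, Nat.cast_sum]
  · rw [← Finset.sum_Ico_sub u (Nat.pow_le_pow_right two_pos (Nat.le_succ (2 * M))),
      Finset.mul_sum, Finset.mul_sum, Finset.sum_div]
    refine Finset.sum_le_sum fun K hK => ?_
    have hw := hS K (Finset.mem_Ico.1 hK).2
    refine le_trans ?_ (le_card_latticeStrip _ (by linarith) _)
    have : (Finset.Ico (3 * S : ℤ) (4 * S)).card = S := by
      rw [Int.card_Ico]; omega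
    rw [this]
    nlinarith [Nat.cast_nonneg (α := ℝ) S]
  · intro K hK K' hK' hne
    rcases lt_or_gt_of_ne hne with h | h
    · exact hdisj K hK K' hK' h
    · exact (hdisj K' hK' K hK h).symm

end Tree

/-! ### Averages over the rectangles -/

namespace PlaneRectangle

/-- The number of lattice points of a rectangle with slope `1 / u`, whose width in the direction of
the rows is `2 * w`. -/
theorem card_latticePoints_le {R : PlaneRectangle} {u w G S : ℝ} (hG : 0 ≤ G) (hS : 1 ≤ S)
    (hw1 : 1 ≤ w) (hw : w ≤ S * G * √(1 + u ^ 2))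
    (hR : ∀ x y : ℝ, (x, y) ∈ R.toSet ↔
      |x * u + y| ≤ (4 + G) * S * (1 + u ^ 2) ∧ |y * u - x| ≤ w) :
    (R.latticePoints.card : ℝ) ≤ 24 * (2 + G) * S * w := by
  set s := √(1 + u ^ 2) with hs
  have hs2 : s ^ 2 = 1 + u ^ 2 := Real.sq_sqrt (by positivity)
  have hs0 : 0 < s := Real.sqrt_pos.2 (by positivity)
  have hus : |u| ≤ s := Real.abs_le_sqrt (by linarith)
  set T := (4 + 2 * G) * S with hT
  -- the half-open strip has width `3 * w` instead of `2 * w`, to contain its right boundary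
  have hsub : R.latticePoints ⊆
      latticeStrip (fun j => u * j - w) (3 * w) (Finset.Icc (-⌊T⌋) ⌊T⌋) := by
    intro q hq
    obtain ⟨h1, h2⟩ := (hR _ _).1 (mem_latticePoints.1 hq)
    rw [mem_latticeStrip]
    have hy : |(q.2 : ℝ)| * s ^ 2 ≤ T * s ^ 2 := by
      calc |(q.2 : ℝ)| * s ^ 2 = |(q.1 * u + q.2) + u * (q.2 * u - q.1)| := by
            rw [← abs_of_nonneg (sq_nonneg s), ← abs_mul, hs2]; ring_nf
        _ ≤ |q.1 * u + q.2| + |u| * |q.2 * u - q.1| := by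
            rw [← abs_mul]; exact abs_add_le _ _
        _ ≤ (4 + G) * S * (1 + u ^ 2) + s * (S * G * s) := by
            gcongr; exact h2.trans hw
        _ = T * s ^ 2 := by rw [hT, ← hs2]; ring
    have hy' := abs_le.1 (le_of_mul_le_mul_right hy (by positivity))
    rw [abs_le] at h2
    refine ⟨Finset.mem_Icc.2 ⟨?_, Int.le_floor.2 hy'.2⟩, by linarith, by linarith⟩
    have : -q.2 ≤ ⌊T⌋ := Int.le_floor.2 (by push_cast; linarith [hy'.1])
    omega
  have hT4 : 4 ≤ T := by rw [hT]; nlinarith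
  have hcard : ((Finset.Icc (-⌊T⌋) ⌊T⌋).card : ℝ) ≤ 3 * T := by
    have h0 : 0 ≤ ⌊T⌋ := Int.floor_nonneg.2 (by linarith)
    have : (((Finset.Icc (-⌊T⌋) ⌊T⌋).card : ℤ) : ℝ) = ((⌊T⌋ + 1 - -⌊T⌋ : ℤ) : ℝ) := by
      rw [Int.card_Icc_of_le _ _ (by omega)]
    rw [Int.cast_natCast] at this
    rw [this]; push_cast
    linarith [Int.floor_le T]
  calc (R.latticePoints.card : ℝ) ≤ _ := Nat.cast_le.2 (Finset.card_le_card hsub)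
    _ ≤ (Finset.Icc (-⌊T⌋) ⌊T⌋).card * (3 * w + 1) := card_latticeStrip_le _ (by linarith) _
    _ ≤ 3 * T * (4 * w) := by gcongr; linarith
    _ = _ := by rw [hT]; ring

/-- Translated to a point of the upper part of a strip, the rectangle covers its lower part. -/
theorem le_average_of_mem_latticeStrip {R : PlaneRectangle} {u w G a : ℝ} {S : ℕ} (hG : 0 ≤ G)
    (hS : 1 ≤ S) (hw2 : 2 ≤ w) (hw : w ≤ S * G * √(1 + u ^ 2))
    (hR : ∀ x y : ℝ, (x, y) ∈ R.toSet ↔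
      |x * u + y| ≤ (4 + G) * S * (1 + u ^ 2) ∧ |y * u - x| ≤ w)
    {E : Finset (ℤ × ℤ)} (hE : latticeStrip (fun j => a + u * j) w (Finset.Ico 0 (S : ℤ)) ⊆ E)
    {p : ℤ × ℤ} (hp : p ∈ latticeStrip (fun j => a + u * j) w (Finset.Ico (3 * S : ℤ) (4 * S))) :
    1 / (48 * (2 + G)) ≤
      R.average (fun q => |(E : Set (ℤ × ℤ)).indicator (fun _ => (1 : ℝ)) q|) p := by
  set s := √(1 + u ^ 2) with hs
  have hs2 : s ^ 2 = 1 + u ^ 2 := Real.sq_sqrt (by positivity)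
  have hs0 : 0 < s := Real.sqrt_pos.2 (by positivity)
  have hus : |u| ≤ s := Real.abs_le_sqrt (by linarith)
  have hS' : (1 : ℝ) ≤ S := by exact_mod_cast hS
  have hP := le_card_latticeStrip (fun j => a + u * j) (w := w) (by linarith) (Finset.Ico 0 (S : ℤ))
  rw [Int.card_Ico, sub_zero, Int.toNat_natCast] at hP
  have hP' : S * w / 2 ≤
      ((latticeStrip (fun j => a + u * j) w (Finset.Ico 0 (S : ℤ))).card : ℝ) := by
    nlinarith
  refine R.le_average_indicator hE ?_ (Finset.card_pos.1 ?_) ?_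
  · intro r hr
    obtain ⟨hj, hp1, hp2⟩ := mem_latticeStrip.1 hp
    obtain ⟨hi, hr1, hr2⟩ := mem_latticeStrip.1 hr
    rw [Finset.mem_Ico] at hi hj
    have hd : |((r.2 : ℝ) - p.2)| ≤ 4 * S := by
      rw [abs_le]
      constructor
      · exact_mod_cast (by omega : -(4 * (S : ℤ)) ≤ r.2 - p.2)
      · exact_mod_cast (by omega : r.2 - p.2 ≤ 4 * (S : ℤ))
    have hx : |((r.2 : ℝ) - p.2) * u - (r.1 - p.1)| ≤ w := by
      rw [abs_le]; constructor <;> linarith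
    rw [mem_latticePoints, hR, Prod.fst_sub, Prod.snd_sub]
    push_cast
    refine ⟨?_, hx⟩
    calc |((r.1 : ℝ) - p.1) * u + (r.2 - p.2)|
        = |(r.2 - p.2) * s ^ 2 - ((r.2 - p.2) * u - (r.1 - p.1)) * u| := by
          rw [hs2]; ring_nf
      _ ≤ |(r.2 : ℝ) - p.2| * s ^ 2 + |((r.2 : ℝ) - p.2) * u - (r.1 - p.1)| * |u| := by
          refine (abs_sub _ _).trans (le_of_eq ?_)
          rw [abs_mul, abs_mul, abs_of_nonneg (sq_nonneg s)]
      _ ≤ 4 * S * s ^ 2 + (S * G * s) * s := by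
          gcongr; exact hx.trans hw
      _ = _ := by rw [hs2.symm]; ring
  · have : (0 : ℝ) < S * w / 2 := by positivity
    exact_mod_cast this.trans_le hP'
  · have := card_latticePoints_le hG hS' (by linarith) hw hR
    rw [one_div, inv_mul_le_iff₀ (by positivity)]
    nlinarith

end PlaneRectangle

/-! ### Failure of the Tauberian condition -/

theorem hasPerronBound_toReal_perronFactor {u : ℕ → ℝ} (hu : StrictMono u)
    (h : perronFactor u < ∞) : HasPerronBound u (perronFactor u).toReal := by
  intro n l hl hln
  have h1 : 0 < u (n + l) - u n := sub_pos.2 (hu (by omega))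
  have h2 : 0 < u (n + 2 * l) - u (n + l) := sub_pos.2 (hu (by omega))
  have h3 : (u (n + 2 * l) - u (n + l)) / (u (n + l) - u n) +
      (u (n + l) - u n) / (u (n + 2 * l) - u (n + l)) ≤ (perronFactor u).toReal := by
    rw [← ENNReal.ofReal_le_iff_le_toReal h.ne]
    exact le_iSup_of_le n (le_iSup_of_le l (le_iSup_of_le ⟨hl, hln⟩ le_rfl))
  have h4 := div_pos h1 h2
  have h5 := div_pos h2 h1
  constructor
  · rw [← div_le_iff₀ h1]; linarith
  · rw [← div_le_iff₀ h2]; linarith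

theorem exists_nat_forall_lt_le_mul {a b : ℕ → ℝ} (hb : ∀ K, 0 < b K) (n : ℕ) :
    ∃ S : ℕ, 1 ≤ S ∧ ∀ K < n, a K ≤ S * b K := by
  have h : ∀ᶠ S : ℕ in atTop, ∀ K ∈ Finset.range n, a K / b K ≤ S :=
    (Filter.eventually_all_finset _).2 fun K _ =>
      tendsto_natCast_atTop_atTop.eventually_ge_atTop (a K / b K)
  obtain ⟨S, hS, hS1⟩ := (h.and (eventually_ge_atTop 1)).exists
  exact ⟨S, hS1, fun K hK => (div_le_iff₀ (hb K)).1 (hS K (Finset.mem_range.2 hK))⟩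

theorem mainTheorem4 (u : ℕ → ℝ) (hu_zero : u 0 = 0) (hu_mono : StrictMono u)
    (hu_growth : ∃ c : ℝ, 0 < c ∧
      ∀ k : ℕ, 1 ≤ k → 1 + u (k - 1) ^ 2 ≥ c * (u k - u (k - 1)) ^ 2)
    (hu_perron : perronFactor u < ∞) :
    ∃ R : ℕ → PlaneRectangle, IsProcess R ∧
      (∀ k : ℕ, 1 ≤ k → (R k).HasSlope (1 / u k)) ∧
      ¬ SatisfiesTauberian R := by
  obtain ⟨c, hc, hgrowth⟩ := hu_growth
  set G : ℝ := 1 / √c with hGdef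
  have hG : 0 ≤ G := by positivity
  have hinc : ∀ K, 0 < u (K + 1) - u K := fun K => sub_pos.2 (hu_mono K.lt_succ_self)
  have hincG : ∀ K, u (K + 1) - u K ≤ G * √(1 + u K ^ 2) := by
    intro K
    have h := hgrowth (K + 1) (by omega)
    rw [Nat.add_sub_cancel] at h
    rw [hGdef, one_div, inv_mul_eq_div, ← Real.sqrt_div' _ hc.le]
    refine Real.le_sqrt_of_sq_le ?_
    rw [le_div_iff₀ hc]; linarith
  have hB := hasPerronBound_toReal_perronFactor hu_mono hu_perron
  set B := (perronFactor u).toReal with hBdef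
  have hB0 : 0 ≤ B := ENNReal.toReal_nonneg
  -- `S N` is the scale of the tree with the indices in `[2 ^ N, 2 ^ (N + 1))`; the factor `K + 2`
  -- makes the shortest sides tend to infinity and the rounding errors in the rows negligible
  choose S hS1 hS using fun N : ℕ => exists_nat_forall_lt_le_mul
    (a := fun K => (K + 2) * √(1 + u K ^ 2)) hinc (2 ^ (N + 1))
  set w : ℕ → ℝ := fun K => S (Nat.log 2 K) * (u (K + 1) - u K) with hwdef
  have hs1 : ∀ K, 1 ≤ √(1 + u K ^ 2) := fun K =>
    Real.one_le_sqrt.2 (by linarith [sq_nonneg (u K)])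
  have hwK : ∀ K, (K + 2) * √(1 + u K ^ 2) ≤ w K := fun K =>
    hS _ K (Nat.lt_pow_succ_log_self one_lt_two K)
  have hwK' : ∀ K : ℕ, (K : ℝ) + 2 ≤ w K := fun K =>
    (le_mul_of_one_le_right (by positivity) (hs1 K)).trans (hwK K)
  have hw0 : ∀ K, 0 < w K := fun K => lt_of_lt_of_le (by positivity) (hwK' K)
  have hwG : ∀ K, w K ≤ S (Nat.log 2 K) * G * √(1 + u K ^ 2) := by
    intro K
    rw [mul_assoc]
    exact mul_le_mul_of_nonneg_left (hincG K) (Nat.cast_nonneg _)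
  have hwH : ∀ K, w K < (4 + G) * S (Nat.log 2 K) * (1 + u K ^ 2) := by
    intro K
    have h1 : √(1 + u K ^ 2) ^ 2 = 1 + u K ^ 2 := Real.sq_sqrt (by positivity)
    have h2 : (1 : ℝ) ≤ S (Nat.log 2 K) := by exact_mod_cast hS1 _
    calc w K ≤ S (Nat.log 2 K) * G * √(1 + u K ^ 2) := hwG K
      _ ≤ S (Nat.log 2 K) * G * (1 + u K ^ 2) := by
          gcongr; nlinarith [hs1 K]
      _ < _ := by
          rw [mul_comm (S _ : ℝ) G]
          have : (0 : ℝ) < S (Nat.log 2 K) * (1 + u K ^ 2) := by positivity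
          nlinarith
  choose R hslope hshort hR using fun K =>
    PlaneRectangle.exists_centred (u K) (hw0 K) (hwH K)
  refine ⟨R, ⟨fun K => ?_, ?_⟩, fun K hK => hslope K ?_, fun hT => ?_⟩
  · rw [hR]
    simp only [zero_mul, add_zero, sub_zero, abs_zero]
    exact ⟨(hw0 K).le.trans (hwH K).le, (hw0 K).le⟩
  · refine tendsto_atTop_mono (fun K => ?_) tendsto_natCast_atTop_atTop
    have := hs1 K
    rw [hshort, le_div_iff₀ (by linarith)]
    nlinarith [hwK K, hw0 K]
  · have := hu_mono (show 0 < K by omega)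
    rw [hu_zero] at this
    exact this.ne'
  obtain ⟨C, hC, hT⟩ := hT (1 / (48 * (2 + G))) (by positivity)
  -- the upper part of the tree has at least `M / (4 * (1 + B))` times as many points as the lower
  obtain ⟨M, hM⟩ := exists_nat_gt (4 * C * (1 + B))
  have hM0 : (0 : ℝ) < M := lt_of_le_of_lt (by positivity) hM
  have hM1 : 1 ≤ M := by exact_mod_cast hM0
  set Q := S (2 * M) with hQ
  have hQ1 : (1 : ℝ) ≤ Q := by exact_mod_cast hS1 _
  have hlog : ∀ K ∈ Finset.Ico (2 ^ (2 * M)) (2 ^ (2 * M + 1)), Nat.log 2 K = 2 * M := fun K hK =>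
    Nat.log_eq_of_pow_le_of_lt_pow (Finset.mem_Ico.1 hK).1 (Finset.mem_Ico.1 hK).2
  have hQinc : ∀ K : ℕ, K < 2 ^ (2 * M + 1) → (K : ℝ) + 2 ≤ Q * (u (K + 1) - u K) := fun K hK =>
    (le_mul_of_one_le_right (by positivity) (hs1 K)).trans (hS (2 * M) K hK)
  set U := u (2 ^ (2 * M + 1)) - u (2 ^ (2 * M)) with hU
  have hQU : M * 2 ^ (2 * M) ≤ Q * U := by
    have h2 : 2 ^ (2 * M) ≤ 2 ^ (2 * M + 1) := Nat.pow_le_pow_right two_pos (Nat.le_succ _)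
    rw [hU, ← Finset.sum_Ico_sub u h2, Finset.mul_sum]
    have h3 := Finset.card_nsmul_le_sum (Finset.Ico (2 ^ (2 * M)) (2 ^ (2 * M + 1)))
      (fun K => Q * (u (K + 1) - u K)) (M : ℝ) fun K hK => by
        rw [Finset.mem_Ico] at hK
        have h4 : M ≤ K := by
          have := (2 * M).lt_two_pow_self
          omega
        have h5 : (M : ℝ) ≤ K := by exact_mod_cast h4
        linarith [hQinc K hK.2]
    refine le_trans (le_of_eq ?_) h3
    rw [Nat.card_Ico, pow_succ, mul_two, Nat.add_sub_cancel, nsmul_eq_mul]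
    push_cast; ring
  set E := latticeTree u M Q (Finset.Ico 0 (Q : ℤ)) with hE
  set F := latticeTree u M Q (Finset.Ico (3 * Q : ℤ) (4 * Q)) with hF
  have hcardF : Q * (Q * U) / 2 ≤ (F.card : ℝ) :=
    le_card_latticeTree hu_mono.monotone hM1 fun K hK =>
      (by linarith [Nat.cast_nonneg (α := ℝ) K] : (2 : ℝ) ≤ (K : ℝ) + 2).trans (hQinc K hK)
  have hcardE : (E.card : ℝ) ≤ Q * (2 * (1 + B) * (Q * U) / M) := by
    refine (card_latticeTree_le hB hu_mono.monotone hB0 hM1).trans ?_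
    refine mul_le_mul_of_nonneg_left ?_ (by linarith)
    have : (2 : ℝ) ^ (2 * M) ≤ Q * U / M := by rw [le_div_iff₀ hM0]; linarith
    calc _ ≤ (1 + 2 * B) * Q * U / M + Q * U / M := by linarith
      _ = _ := by ring
  have hFsub : (F : Set (ℤ × ℤ)) ⊆ {p : ℤ × ℤ | ENNReal.ofReal (1 / (48 * (2 + G))) ≤
      discreteMaximal R ((E : Set (ℤ × ℤ)).indicator fun _ => 1) p} := by
    intro p hp
    obtain ⟨K, hK, hpK⟩ := Finset.mem_biUnion.1 (Finset.mem_coe.1 hp)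
    have hK1 : 1 ≤ K := Nat.one_le_two_pow.trans (Finset.mem_Ico.1 hK).1
    have hwG' := hwG K
    have hRK := hR K
    simp only [hwdef] at hwG' hRK
    rw [hlog K hK] at hwG'
    simp only [hlog K hK] at hRK
    have hEK := Finset.subset_biUnion_of_mem (fun K => latticeStrip
      (fun j => Q * treeShift u M K + u K * j) (Q * (u (K + 1) - u K)) (Finset.Ico 0 (Q : ℤ))) hK
    rw [Set.mem_ofPred_eq, discreteMaximal]
    refine le_iSup_of_le K (le_iSup_of_le hK1 (ENNReal.ofReal_le_ofReal ?_))
    refine PlaneRectangle.le_average_of_mem_latticeStrip hG (hS1 _) ?_ hwG' hRK hEK hpK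
    linarith [hQinc K (Finset.mem_Ico.1 hK).2, Nat.cast_nonneg (α := ℝ) K]
  have hEne : E.Nonempty := by
    set K := 2 ^ (2 * M) with hKdef
    have hK : K ∈ Finset.Ico (2 ^ (2 * M)) (2 ^ (2 * M + 1)) :=
      Finset.mem_Ico.2 ⟨le_rfl, Nat.pow_lt_pow_right one_lt_two (Nat.lt_succ_self _)⟩
    have h2 := hQinc K (Finset.mem_Ico.1 hK).2
    have h3 := le_card_latticeStrip (fun j => Q * treeShift u M K + u K * j)
      (w := Q * (u (K + 1) - u K)) (by linarith [Nat.cast_nonneg (α := ℝ) K]) (Finset.Ico 0 (Q : ℤ))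
    rw [Int.card_Ico, sub_zero, Int.toNat_natCast] at h3
    have h4 : (0 : ℝ) < Q * (Q * (u (K + 1) - u K) - 1) :=
      mul_pos (by linarith) (by linarith [Nat.cast_nonneg (α := ℝ) K])
    refine Finset.Nonempty.mono (Finset.subset_biUnion_of_mem (fun K => latticeStrip
      (fun j => Q * treeShift u M K + u K * j) (Q * (u (K + 1) - u K)) (Finset.Ico 0 (Q : ℤ))) hK)
      (Finset.card_pos.1 ?_)
    exact_mod_cast h4.trans_le h3
  have hFE : (F.card : ℝ) ≤ C * E.card := by
    have h1 : ((F.card : ℕ) : ℝ≥0∞) ≤ ENNReal.ofReal C * (E.card : ℝ≥0∞) := by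
      refine le_trans ?_ (hT E hEne)
      have h2 := Set.encard_le_encard hFsub
      rw [Set.encard_coe_eq_coe_finsetCard] at h2
      exact_mod_cast ENat.toENNReal_le.2 h2
    rw [← ENNReal.ofReal_natCast, ← ENNReal.ofReal_natCast, ← ENNReal.ofReal_mul hC.le] at h1
    exact (ENNReal.ofReal_le_ofReal_iff (by positivity)).1 h1
  have hpos : 0 < Q * (Q * U) := by
    have : (0 : ℝ) < M * 2 ^ (2 * M) := by positivity
    exact mul_pos (by linarith) (this.trans_le hQU)
  have h1 := hcardF.trans (hFE.trans (mul_le_mul_of_nonneg_left hcardE hC.le))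
  have h2 : M * (Q * (Q * U)) ≤ 4 * C * (1 + B) * (Q * (Q * U)) := by
    have h3 := mul_le_mul_of_nonneg_left h1 (by positivity : (0 : ℝ) ≤ 2 * M)
    have h4 : 2 * M * (C * (Q * (2 * (1 + B) * (Q * U) / M))) =
        4 * C * (1 + B) * (Q * (Q * U)) := by field_simp; ring
    linarith
  exact hM.not_ge (le_of_mul_le_mul_right h2 hpos)
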